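/- Let $X_1,\dots,X_n$ be independent identically distributed real random variables with common law $F$, let $a=(a_1,\dots,a_n)\in\mathbf R^n$, $a\neq0$, and let $F_a$ be the law of $\sum_{k=1}^n a_kX_k$. Let $Q(H,\lambda)=\sup_{x\in\mathbf R}H\{[x,x+\lambda]\}$ be the Lévy concentration function of a law $H$. Let $\widetilde X$ be the difference of two independent random variables with law $F$, and put $M(\tau)=\mathbf E\min\{\widetilde X^2/\tau^2,1\}$ for $\tau>0$, and $P=\mathbf P(\widetilde X\ne0)$. For $L>0$ let $f_L(t)=t/6$ for $0<t<eL$ and $f_L(t)=L\sqrt{\log(t/L)}$ for $t\ge eL$, and let $$D^*(a)=\inf\{t>0:\ \mathrm{dist}(ta,\mathbf Z^n)<f_L(t\|a\|)\},$$ where $\|\cdot\|$ and $\mathrm{dist}$ are Euclidean (so that, by definition, the arithmetic condition $\|ta-m\|\ge f_L(t\|a\|)$ holds for all $m\in\mathbf Z^n$ and $0<t<D^*(a)$). Assume that $P>0$ and $L^2>1/P$. Then $P=\lim_{\tau\to0+}M(\tau)$, and there exists $\tau_0>0$ with $L^2=1/M(\tau_0)$. Moreover, there is an absolute constant $c>0$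 such that, for every such $\tau_0$ and $\varepsilon_0=\tau_0/D^*(a)$, $$Q(F_a,\varepsilon)\le\frac{c}{\|a\|\,D^*(a)\sqrt{M(\varepsilon D^*(a))}}\quad\text{for }0<\varepsilon\le\varepsilon_0,$$ $$Q(F_a,\varepsilon)\le\frac{c\,\varepsilon L}{\varepsilon_0\,\|a\|\,D^*(a)}\quad\text{for }\varepsilon\ge\varepsilon_0.$$ -/

import Mathlib

open MeasureTheory ProbabilityTheory Filter Topology

noncomputable section

namespace LittlewoodOfford

/-- The Lévy concentration function `Q(F, s) = sup_x F[x, x + s]`. -/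
def concentration (F : Measure ℝ) (s : ℝ) : ℝ :=
  ⨆ x : ℝ, F.real (Set.Icc x (x + s))

/-- The law `G` of `X₁ - X₂`, where `X₁`, `X₂` are independent with law `F`. -/
def symmetrized (F : Measure ℝ) : Measure ℝ :=
  (F.prod F).map (fun p : ℝ × ℝ => p.1 - p.2)

/-- `M(τ) = E min (X̃ ^ 2 / τ ^ 2, 1)`, where `X̃` has law `symmetrized F`. -/
def truncMoment (F : Measure ℝ) (τ : ℝ) : ℝ :=
  ∫ x, min (x ^ 2 / τ ^ 2) 1 ∂(symmetrized F)

/-- `P = P(X̃ ≠ 0)`. -/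
def probNonzero (F : Measure ℝ) : ℝ :=
  (symmetrized F).real {x | x ≠ 0}

/-- The function `f_L`. -/
def fL (L t : ℝ) : ℝ :=
  if t < Real.exp 1 * L then t / 6 else L * √(Real.log (t / L))

/-- The integer points `ℤⁿ` of `ℝⁿ`. -/
def integerPoints (n : ℕ) : Set (EuclideanSpace ℝ (Fin n)) :=
  {m | ∀ k, ∃ z : ℤ, m k = z}

/-- The alternative least common denominator
`D*(a) = inf {t > 0 : dist (t a, ℤⁿ) < f_L (t ‖a‖)}`, with Euclidean norm and distance. -/
def altDenominator (L : ℝ) {n : ℕ} (a : EuclideanSpace ℝ (Fin n)) : ℝ :=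
  sInf {t : ℝ | 0 < t ∧ Metric.infDist (t • a) (integerPoints n) < fL L (t * ‖a‖)}

/-- The arithmetic condition `‖t a - m‖ ≥ f_L (t ‖a‖)` for all `m ∈ ℤⁿ` holds automatically
for `0 < t < D*(a)`. -/
theorem fL_le_norm_sub {L : ℝ} {n : ℕ} {a : EuclideanSpace ℝ (Fin n)} {t : ℝ} (ht : 0 < t)
    (htD : t < altDenominator L a) {m : EuclideanSpace ℝ (Fin n)} (hm : m ∈ integerPoints n) :
    fL L (t * ‖a‖) ≤ ‖t • a - m‖ := by
  by_contra! h
  rw [← dist_eq_norm] at h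
  have hle : altDenominator L a ≤ t :=
    csInf_le ⟨0, fun s hs => hs.1.le⟩ ⟨ht, (Metric.infDist_le_dist_of_mem hm).trans_lt h⟩
  exact absurd htD (not_lt.mpr hle)

end LittlewoodOfford

end

/-!
The proof compares characteristic functions. Write `G` for the law of the symmetrization,
`D = D*(a)`, `τ = ε D`, `M = M(τ)`, and `S(s) = ∑ k, (1 - cos (a k s))` (`cosDefect`).

Esseen's inequality bounds `Q(F_a, ε)` by `4 ε ∫ |φ(t)| dt` over `0 < t < 1 / ε`, and
`|φ(t)| ≤ exp (-½ ∫ S(t x) dG(x))`. Jensen's inequality with respect to the probability measure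
`(m / M) • G`, where `m(x) = min (x² / τ², 1)`, moves the integral over `x` outside:
`|φ(t)| ≤ M⁻¹ ∫ m(x) exp (-(M / (2 m(x))) S(t x)) dG(x)`. It remains to bound the integral in `t`
of the exponential by a constant times `1 / (‖a‖ √M τ)`, uniformly in `x ≠ 0`
(`integral_exp_neg_div_mul_cosDefect_le`).

After the substitution `s = t |x|`, two facts are used. Since `1 - cos (2 π y) ≥ 8 dist (y, ℤ)²`,
the arithmetic condition gives `S(2 π u) ≥ 8 f_L(u ‖a‖)²` for `0 < u < D`, so that
`exp (-(B / 2) S)` has integral at most a constant times `1 / (‖a‖ √B)` over `[0, D]` as soon as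
`B L² ≥ 1` (`integral_exp_neg_cosDefect_le`). When `|x| < τ` this is enough, with
`B = M τ² / x²`. When `|x| ≥ τ` the variable `s` leaves `[0, D]`; but `exp (-(M / 2) S)` is a
positive multiple of the exponential of a nonnegative combination of cosines, hence positive
definite, and its integral over any interval of length `D / 2` is at most four times its integral
over `[0, D]` (`IsCosineSum.integral_exp_translate_le`).

The condition `B L² ≥ 1` holds because `ε ≤ τ₀ / D` gives `M(τ) ≥ M(τ₀) = 1 / L²`. The range
`ε ≥ τ₀ / D` follows by covering an interval of length `ε` by intervals of length `τ₀ / D`.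
-/

open MeasureTheory ProbabilityTheory Filter Topology

noncomputable section

namespace LittlewoodOfford

/-! ### The triangular kernel and Esseen's inequality -/

theorem integral_triangle_mul_cos {T : ℝ} (hT : 0 < T) {u : ℝ} (hu : u ≠ 0) :
    ∫ t in (0 : ℝ)..T, (1 - t / T) * Real.cos (u * t) = (1 - Real.cos (u * T)) / (u ^ 2 * T) := by
  have hderiv : ∀ t ∈ Set.uIcc 0 T,
      HasDerivAt (fun t => (1 - t / T) * Real.sin (u * t) / u - Real.cos (u * t) / (u ^ 2 * T))
        ((1 - t / T) * Real.cos (u * t)) t := by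
    intro t _
    have h1 : HasDerivAt (fun t => u * t) u t := by simpa using (hasDerivAt_id t).const_mul u
    have h2 : HasDerivAt (fun t => 1 - t / T) (-(1 / T)) t := by
      simpa using ((hasDerivAt_id t).div_const T).const_sub 1
    refine (((h2.mul h1.sin).div_const u).sub (h1.cos.div_const (u ^ 2 * T))).congr_deriv ?_
    field_simp
    ring
  rw [intervalIntegral.integral_eq_sub_of_hasDerivAt hderiv
    (Continuous.intervalIntegrable (by fun_prop) _ _)]
  simp [hT.ne']
  ring

/-- The cosine transform of the triangular kernel is nonnegative. -/
theorem integral_triangle_mul_cos_nonneg {T : ℝ} (hT : 0 < T) (u : ℝ) :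
    0 ≤ ∫ t in (0 : ℝ)..T, (1 - t / T) * Real.cos (u * t) := by
  rcases eq_or_ne u 0 with rfl | hu
  · refine intervalIntegral.integral_nonneg hT.le fun t ht => ?_
    have : t / T ≤ 1 := (div_le_one hT).2 ht.2
    simpa using this
  · rw [integral_triangle_mul_cos hT hu]
    have := Real.cos_le_one (u * T)
    exact div_nonneg (by linarith) (by positivity)

theorem integral_triangle {T : ℝ} (hT : 0 < T) :
    ∫ t in (0 : ℝ)..T, (1 - t / T) = T / 2 := by
  rw [intervalIntegral.integral_sub (by simp) (Continuous.intervalIntegrable (by fun_prop) _ _),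
    intervalIntegral.integral_div]
  simp
  field_simp
  ring

theorem le_integral_triangle_mul_cos {T : ℝ} (hT : 0 < T) {u : ℝ} (hu : |u| * T ≤ 1) :
    T / 4 ≤ ∫ t in (0 : ℝ)..T, (1 - t / T) * Real.cos (u * t) := by
  calc T / 4 = ∫ t in (0 : ℝ)..T, (1 - t / T) * (1 / 2) := by
        rw [intervalIntegral.integral_mul_const, integral_triangle hT]; ring
    _ ≤ _ := by
        refine intervalIntegral.integral_mono_on hT.le
          (Continuous.intervalIntegrable (by fun_prop) _ _)
          (Continuous.intervalIntegrable (by fun_prop) _ _) fun t ht => ?_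
        have h1 : t / T ≤ 1 := (div_le_one hT).2 ht.2
        have h2 := Real.one_sub_sq_div_two_le_cos (x := u * t)
        have h3 : |u * t| ≤ 1 := by
          rw [abs_mul, abs_of_nonneg ht.1]
          exact (mul_le_mul_of_nonneg_left ht.2 (abs_nonneg u)).trans hu
        have h4 : (u * t) ^ 2 ≤ 1 := (sq_le_one_iff_abs_le_one _).2 h3
        exact mul_le_mul_of_nonneg_left (by linarith) (by linarith)

theorem integral_cos_sub_mul_le (H : Measure ℝ) [IsProbabilityMeasure H] (x t : ℝ) :
    ∫ y, Real.cos ((y - x) * t) ∂H ≤ ‖charFun H t‖ := by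
  have h : (∫ y, Real.cos ((y - x) * t) ∂H)
      = (Complex.exp (-(x * t : ℝ) * Complex.I) * charFun H t).re := by
    rw [charFun_apply_real, ← integral_const_mul]
    have hi : Integrable (fun y : ℝ => Complex.exp (-(x * t : ℝ) * Complex.I) *
        Complex.exp (t * y * Complex.I)) H := by
      refine Integrable.of_bound (by fun_prop) 1 (ae_of_all _ fun y => ?_)
      rw [norm_mul, ← Complex.ofReal_neg, ← Complex.ofReal_mul, Complex.norm_exp_ofReal_mul_I,
        Complex.norm_exp_ofReal_mul_I, mul_one]
    rw [← RCLike.re_eq_complex_re, ← integral_re hi]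
    refine integral_congr_ae (ae_of_all _ fun y => ?_)
    simp only [RCLike.re_eq_complex_re]
    rw [← Complex.exp_add, show (-(x * t : ℝ) * Complex.I + t * y * Complex.I : ℂ) =
      ((y - x) * t : ℝ) * Complex.I by push_cast; ring, Complex.exp_ofReal_mul_I_re]
  rw [h]
  refine (Complex.re_le_norm _).trans ?_
  rw [norm_mul, ← Complex.ofReal_neg, Complex.norm_exp_ofReal_mul_I, one_mul]

/-- **Esseen's inequality**: the concentration function is controlled by the mean of the
characteristic function near the origin. -/
theorem concentration_le_integral_charFun (H : Measure ℝ) [IsProbabilityMeasure H] {ε : ℝ}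
    (hε : 0 < ε) :
    concentration H ε ≤ 4 * ε * ∫ t in (0 : ℝ)..ε⁻¹, ‖charFun H t‖ := by
  refine ciSup_le fun x => ?_
  set T := ε⁻¹ with hTdef
  have hT : 0 < T := inv_pos.2 hε
  have hfin : IsFiniteMeasure (volume.restrict (Set.uIoc 0 T)) :=
    ⟨by simp [Set.uIoc_of_le hT.le]⟩
  set ψ : ℝ → ℝ := fun y => ∫ t in (0 : ℝ)..T, (1 - t / T) * Real.cos ((y - x) * t)
  have hint : Integrable (Function.uncurry fun (t y : ℝ) => (1 - t / T) * Real.cos ((y - x) * t))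
      ((volume.restrict (Set.uIoc 0 T)).prod H) := by
    refine Integrable.mono' (g := fun _ => 1) (integrable_const _)
      (Continuous.aestronglyMeasurable (by fun_prop)) ?_
    have h0 : ∀ᵐ p : ℝ × ℝ ∂((volume.restrict (Set.uIoc 0 T)).prod H), p.1 ∈ Set.uIoc 0 T :=
      Measure.quasiMeasurePreserving_fst.ae (ae_restrict_mem measurableSet_uIoc)
    filter_upwards [h0] with p hp
    rw [Set.uIoc_of_le hT.le] at hp
    have h1 : p.1 / T ≤ 1 := (div_le_one hT).2 hp.2
    have h2 : 0 ≤ p.1 / T := div_nonneg hp.1.le hT.le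
    simp only [Function.uncurry]
    rw [Real.norm_eq_abs, abs_mul, abs_of_nonneg (by linarith : 0 ≤ 1 - p.1 / T)]
    exact mul_le_one₀ (by linarith) (abs_nonneg _) (Real.abs_cos_le_one _)
  have hψ : Integrable ψ H := by
    have := hint.integral_prod_right
    simpa only [ψ, intervalIntegral.integral_of_le hT.le, Set.uIoc_of_le hT.le,
      Function.uncurry] using this
  have hlow : T / 4 * H.real (Set.Icc x (x + ε)) ≤ ∫ y, ψ y ∂H := by
    have : T / 4 * H.real (Set.Icc x (x + ε)) =
        ∫ y, (Set.Icc x (x + ε)).indicator (fun _ => T / 4) y ∂H := by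
      rw [integral_indicator_const _ measurableSet_Icc, smul_eq_mul, mul_comm]
    rw [this]
    refine integral_mono ((integrable_const _).indicator measurableSet_Icc) hψ fun y => ?_
    by_cases hy : y ∈ Set.Icc x (x + ε)
    · rw [Set.indicator_of_mem hy]
      refine le_integral_triangle_mul_cos hT ?_
      rw [abs_of_nonneg (by linarith [hy.1]), hTdef, ← div_eq_mul_inv, div_le_one hε]
      linarith [hy.2]
    · rw [Set.indicator_of_notMem hy]
      exact integral_triangle_mul_cos_nonneg hT _
  have hup : ∫ y, ψ y ∂H ≤ ∫ t in (0 : ℝ)..T, ‖charFun H t‖ := by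
    rw [← intervalIntegral_integral_swap hint]
    refine intervalIntegral.integral_mono_on hT.le ?_ ?_ fun t ht => ?_
    · rw [intervalIntegrable_iff]
      exact hint.integral_prod_left
    · exact intervalIntegrable_charFun.norm
    · rw [integral_const_mul]
      have h1 : t / T ≤ 1 := (div_le_one hT).2 ht.2
      have h2 : 0 ≤ t / T := div_nonneg ht.1 hT.le
      calc _ ≤ (1 - t / T) * ‖charFun H t‖ :=
            mul_le_mul_of_nonneg_left (integral_cos_sub_mul_le H x t) (by linarith)
        _ ≤ _ := mul_le_of_le_one_left (norm_nonneg _) (by linarith)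
  have h : T / 4 * H.real (Set.Icc x (x + ε)) ≤ ∫ t in (0 : ℝ)..T, ‖charFun H t‖ :=
    hlow.trans hup
  have h' := mul_le_mul_of_nonneg_left h (by positivity : 0 ≤ 4 * ε)
  rwa [show 4 * ε * (T / 4 * H.real (Set.Icc x (x + ε))) = H.real (Set.Icc x (x + ε)) by
    rw [hTdef]; field_simp] at h'

/-! ### Nonnegative combinations of cosines and translation of integrals -/

/-- The functions `s ↦ ∑ j, c j * cos (θ j * s)` with finitely many terms and all `c j ≥ 0`:
the real even positive definite trigonometric sums. -/
inductive IsCosineSum : (ℝ → ℝ) → Prop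
  | const_mul_cos {c : ℝ} (hc : 0 ≤ c) (θ : ℝ) : IsCosineSum fun s => c * Real.cos (θ * s)
  | add {f g : ℝ → ℝ} : IsCosineSum f → IsCosineSum g → IsCosineSum fun s => f s + g s

namespace IsCosineSum

variable {f g : ℝ → ℝ}

theorem const {c : ℝ} (hc : 0 ≤ c) : IsCosineSum fun _ => c := by
  simpa using const_mul_cos hc 0

theorem sum {ι : Type*} (t : Finset ι) {f : ι → ℝ → ℝ} (hf : ∀ i ∈ t, IsCosineSum (f i)) :
    IsCosineSum fun s => ∑ i ∈ t, f i s := by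
  classical
  induction t using Finset.induction_on with
  | empty => simpa using const le_rfl
  | insert i t hi ih =>
    simp only [Finset.sum_insert hi]
    exact (hf i (by simp)).add (ih fun j hj => hf j (by simp [hj]))

theorem mul (hf : IsCosineSum f) (hg : IsCosineSum g) : IsCosineSum fun s => f s * g s := by
  induction hf with
  | @const_mul_cos c hc θ =>
    induction hg with
    | @const_mul_cos d hd η =>
      convert (const_mul_cos (by positivity : 0 ≤ c * d / 2) (θ + η)).add
        (const_mul_cos (by positivity : 0 ≤ c * d / 2) (θ - η)) using 2 with s
      rw [add_mul, sub_mul, Real.cos_add, Real.cos_sub]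
      ring
    | add _ _ ih₁ ih₂ => simpa only [mul_add] using ih₁.add ih₂
  | add _ _ ih₁ ih₂ => simpa only [add_mul] using ih₁.add ih₂

theorem pow (hf : IsCosineSum f) (N : ℕ) : IsCosineSum fun s => f s ^ N := by
  induction N with
  | zero => simpa using const zero_le_one
  | succ N ih => simpa only [pow_succ] using ih.mul hf

theorem continuous (hf : IsCosineSum f) : Continuous f := by
  induction hf with
  | const_mul_cos hc θ => fun_prop
  | add _ _ ih₁ ih₂ => exact ih₁.add ih₂

theorem exists_abs_le (hf : IsCosineSum f) : ∃ C, ∀ s, |f s| ≤ C := by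
  induction hf with
  | @const_mul_cos c hc θ =>
    refine ⟨c, fun s => ?_⟩
    rw [abs_mul, abs_of_nonneg hc]
    exact mul_le_of_le_one_right hc (Real.abs_cos_le_one _)
  | add _ _ ih₁ ih₂ =>
    obtain ⟨C, hC⟩ := ih₁
    obtain ⟨D, hD⟩ := ih₂
    exact ⟨C + D, fun s => (abs_add_le _ _).trans (add_le_add (hC s) (hD s))⟩

/-- Weighted by the triangular kernel, a nonnegative combination of cosines has its largest
integral when centred at the origin. -/
theorem integral_triangle_translate_le (hf : IsCosineSum f) {R : ℝ} (hR : 0 < R) (r : ℝ) :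
    ∫ s in (0 : ℝ)..R, (1 - s / R) * (f (r + s) + f (r - s)) ≤
      ∫ s in (0 : ℝ)..R, (1 - s / R) * (2 * f s) := by
  induction hf with
  | @const_mul_cos c hc θ =>
    have h1 : ∀ s, (1 - s / R) * (c * Real.cos (θ * (r + s)) + c * Real.cos (θ * (r - s))) =
        (2 * c * Real.cos (θ * r)) * ((1 - s / R) * Real.cos (θ * s)) := fun s => by
      rw [mul_add θ, mul_sub θ, Real.cos_add, Real.cos_sub]; ring
    have h2 : ∀ s, (1 - s / R) * (2 * (c * Real.cos (θ * s))) =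
        (2 * c) * ((1 - s / R) * Real.cos (θ * s)) := fun s => by ring
    simp only [h1, h2, intervalIntegral.integral_const_mul]
    refine mul_le_mul_of_nonneg_right ?_ (integral_triangle_mul_cos_nonneg hR θ)
    exact mul_le_of_le_one_right (by positivity) (Real.cos_le_one _)
  | @add f g hf hg ih₁ ih₂ =>
    have := hf.continuous
    have := hg.continuous
    have h1 : ∀ s, (1 - s / R) * ((f (r + s) + g (r + s)) + (f (r - s) + g (r - s))) =
        (1 - s / R) * (f (r + s) + f (r - s)) + (1 - s / R) * (g (r + s) + g (r - s)) :=
      fun s => by ring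
    have h2 : ∀ s, (1 - s / R) * (2 * (f s + g s)) =
        (1 - s / R) * (2 * f s) + (1 - s / R) * (2 * g s) := fun s => by ring
    simp only [h1, h2]
    rw [intervalIntegral.integral_add, intervalIntegral.integral_add]
    · exact add_le_add ih₁ ih₂
    all_goals exact Continuous.intervalIntegrable (by fun_prop) _ _

/-- The centring inequality passes to `exp ∘ f = lim (1 + f / N) ^ N`. -/
theorem integral_triangle_translate_exp_le (hf : IsCosineSum f) {R : ℝ} (hR : 0 < R) (r : ℝ) :
    ∫ s in (0 : ℝ)..R, (1 - s / R) * (Real.exp (f (r + s)) + Real.exp (f (r - s))) ≤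
      ∫ s in (0 : ℝ)..R, (1 - s / R) * (2 * Real.exp (f s)) := by
  obtain ⟨C, hC⟩ := hf.exists_abs_le
  have hcont := hf.continuous
  have happrox : ∀ N : ℕ, IsCosineSum fun s => (1 + f s / N) ^ N := fun N => by
    have : IsCosineSum fun s => 1 + f s / N := by
      simpa only [div_eq_mul_inv] using
        (const zero_le_one).add (hf.mul (const (inv_nonneg.2 (Nat.cast_nonneg N))))
    exact this.pow N
  have hbound : ∀ (N : ℕ) s, |(1 + f s / N) ^ N| ≤ Real.exp C := fun N s => by
    rcases N.eq_zero_or_pos with rfl | hN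
    · simpa using (abs_nonneg _).trans (hC 0)
    have hN' : (0 : ℝ) < N := Nat.cast_pos.2 hN
    have h1 : |1 + f s / N| ≤ 1 + C / N := by
      refine (abs_add_le _ _).trans ?_
      rw [abs_one, abs_div, abs_of_pos hN']
      gcongr
      exact hC s
    have h2 : 1 + C / N ≤ Real.exp (C / N) := by linarith [Real.add_one_le_exp (C / N)]
    rw [abs_pow]
    calc _ ≤ Real.exp (C / N) ^ N := pow_le_pow_left₀ (abs_nonneg _) (h1.trans h2) N
      _ = _ := by rw [← Real.exp_nat_mul, mul_div_cancel₀ _ hN'.ne']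
  have hlim : ∀ s, Tendsto (fun N : ℕ => (1 + f s / N) ^ N) atTop (𝓝 (Real.exp (f s))) :=
    fun s => Real.tendsto_one_add_div_pow_exp (f s)
  have hw : ∀ s ∈ Set.uIoc 0 R, |1 - s / R| ≤ 1 := fun s hs => by
    rw [Set.uIoc_of_le hR.le] at hs
    have h1 : s / R ≤ 1 := (div_le_one hR).2 hs.2
    have h2 : 0 ≤ s / R := div_nonneg hs.1.le hR.le
    rw [abs_le]
    constructor <;> linarith
  refine le_of_tendsto_of_tendsto' (b := atTop)
    (f := fun N : ℕ => ∫ s in (0 : ℝ)..R, (1 - s / R) *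
      ((1 + f (r + s) / N) ^ N + (1 + f (r - s) / N) ^ N))
    (g := fun N : ℕ => ∫ s in (0 : ℝ)..R, (1 - s / R) * (2 * (1 + f s / N) ^ N))
    ?_ ?_ fun N => (happrox N).integral_triangle_translate_le hR r
  · refine intervalIntegral.tendsto_integral_filter_of_dominated_convergence
      (fun _ => Real.exp C + Real.exp C) (Eventually.of_forall fun N =>
        Continuous.aestronglyMeasurable (by fun_prop))
      (Eventually.of_forall fun N => ae_of_all _ fun s hs => ?_) (by simp)
      (ae_of_all _ fun s _ => ((hlim _).add (hlim _)).const_mul _)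
    rw [Real.norm_eq_abs, abs_mul]
    refine (mul_le_of_le_one_left (abs_nonneg _) (hw s hs)).trans ?_
    exact (abs_add_le _ _).trans (add_le_add (hbound N _) (hbound N _))
  · refine intervalIntegral.tendsto_integral_filter_of_dominated_convergence
      (fun _ => 2 * Real.exp C) (Eventually.of_forall fun N =>
        Continuous.aestronglyMeasurable (by fun_prop))
      (Eventually.of_forall fun N => ae_of_all _ fun s hs => ?_) (by simp)
      (ae_of_all _ fun s _ => ((hlim _).const_mul _).const_mul _)
    rw [Real.norm_eq_abs, abs_mul]
    refine (mul_le_of_le_one_left (abs_nonneg _) (hw s hs)).trans ?_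
    rw [abs_mul, abs_two]
    exact mul_le_mul_of_nonneg_left (hbound N _) zero_le_two

/-- The integral of `exp ∘ f` over an interval of length `R / 2`, wherever it lies, is controlled
by the integral over `[0, R]`. -/
theorem integral_exp_translate_le (hf : IsCosineSum f) {R : ℝ} (hR : 0 < R) (r : ℝ) :
    ∫ s in r..(r + R / 2), Real.exp (f s) ≤ 4 * ∫ s in (0 : ℝ)..R, Real.exp (f s) := by
  have hcont := hf.continuous
  have hw : ∀ s ∈ Set.Icc 0 R, 0 ≤ 1 - s / R := fun s hs => by
    have h1 : s / R ≤ 1 := (div_le_one hR).2 hs.2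
    linarith
  have hpos : ∀ s, 0 < Real.exp (f s) := fun s => Real.exp_pos _
  calc ∫ s in r..(r + R / 2), Real.exp (f s)
      = ∫ s in (0 : ℝ)..(R / 2), Real.exp (f (r + s)) := by
        rw [intervalIntegral.integral_comp_add_left (fun s => Real.exp (f s)), add_zero]
    _ ≤ ∫ s in (0 : ℝ)..(R / 2),
          2 * ((1 - s / R) * (Real.exp (f (r + s)) + Real.exp (f (r - s)))) := by
        refine intervalIntegral.integral_mono_on (by positivity)
          (Continuous.intervalIntegrable (by fun_prop) _ _)
          (Continuous.intervalIntegrable (by fun_prop) _ _) fun s hs => ?_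
        have h1 : s / R ≤ 1 / 2 := by rw [div_le_iff₀ hR]; linarith [hs.2]
        nlinarith [hpos (r + s), hpos (r - s),
          mul_nonneg (by linarith : 0 ≤ 1 / 2 - s / R) (hpos (r + s)).le,
          mul_nonneg (by linarith : 0 ≤ 1 / 2 - s / R) (hpos (r - s)).le]
    _ ≤ ∫ s in (0 : ℝ)..R,
          2 * ((1 - s / R) * (Real.exp (f (r + s)) + Real.exp (f (r - s)))) := by
        refine intervalIntegral.integral_mono_interval le_rfl (by positivity) (by linarith) ?_
          (Continuous.intervalIntegrable (by fun_prop) _ _)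
        refine (ae_restrict_iff' measurableSet_Ioc).2 (ae_of_all _ fun s hs => ?_)
        have := hw s ⟨hs.1.le, hs.2⟩
        have := hpos (r + s)
        have := hpos (r - s)
        positivity
    _ ≤ 2 * ∫ s in (0 : ℝ)..R, (1 - s / R) * (2 * Real.exp (f s)) := by
        rw [intervalIntegral.integral_const_mul]
        exact mul_le_mul_of_nonneg_left (hf.integral_triangle_translate_exp_le hR r) zero_le_two
    _ ≤ 2 * ∫ s in (0 : ℝ)..R, 2 * Real.exp (f s) := by
        refine mul_le_mul_of_nonneg_left (intervalIntegral.integral_mono_on hR.le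
          (Continuous.intervalIntegrable (by fun_prop) _ _)
          (Continuous.intervalIntegrable (by fun_prop) _ _) fun s hs => ?_) zero_le_two
        have : 0 ≤ s / R := div_nonneg hs.1 hR.le
        have := hpos s
        exact mul_le_of_le_one_left (by positivity) (by linarith)
    _ = _ := by rw [intervalIntegral.integral_const_mul]; ring

theorem integral_exp_le_of_le (hf : IsCosineSum f) {R R' : ℝ} (hR : 0 < R) (hR' : R ≤ R') :
    ∫ s in (0 : ℝ)..R', Real.exp (f s) ≤ 12 * (R' / R) * ∫ s in (0 : ℝ)..R, Real.exp (f s) := by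
  have hcont := hf.continuous
  have hint : ∀ a b : ℝ, IntervalIntegrable (fun s => Real.exp (f s)) volume a b :=
    fun a b => Continuous.intervalIntegrable (by fun_prop) _ _
  have hcover : ∀ N : ℕ, ∫ s in (0 : ℝ)..(N * (R / 2)), Real.exp (f s) ≤
      N * (4 * ∫ s in (0 : ℝ)..R, Real.exp (f s)) := by
    intro N
    induction N with
    | zero => simp
    | succ N ih =>
      rw [← intervalIntegral.integral_add_adjacent_intervals (hint 0 (N * (R / 2))) (hint _ _)]
      have := hf.integral_exp_translate_le hR (N * (R / 2))
      rw [show ((N + 1 : ℕ) : ℝ) * (R / 2) = N * (R / 2) + R / 2 by push_cast; ring]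
      push_cast
      linarith
  have hJ : 0 ≤ ∫ s in (0 : ℝ)..R, Real.exp (f s) :=
    intervalIntegral.integral_nonneg hR.le fun s _ => (Real.exp_pos _).le
  have hN : 2 * R' / R ≤ ⌈2 * R' / R⌉₊ := Nat.le_ceil _
  have hN' : (⌈2 * R' / R⌉₊ : ℝ) < 2 * R' / R + 1 :=
    Nat.ceil_lt_add_one (div_nonneg (by linarith) hR.le)
  have hq : 1 ≤ R' / R := (one_le_div hR).2 hR'
  have hle : R' ≤ ⌈2 * R' / R⌉₊ * (R / 2) := by
    rw [div_le_iff₀ hR] at hN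
    linarith
  calc _ ≤ ∫ s in (0 : ℝ)..(⌈2 * R' / R⌉₊ * (R / 2)), Real.exp (f s) :=
        intervalIntegral.integral_mono_interval le_rfl (by linarith) hle
          (ae_of_all _ fun s => (Real.exp_pos _).le) (hint _ _)
    _ ≤ _ := hcover _
    _ ≤ (3 * (R' / R)) * (4 * ∫ s in (0 : ℝ)..R, Real.exp (f s)) := by
        refine mul_le_mul_of_nonneg_right ?_ (by positivity)
        rw [mul_div_assoc] at hN'
        rw [mul_div_assoc]
        linarith
    _ = _ := by ring

end IsCosineSum

/-! ### Symmetrization and the characteristic function of the weighted sum -/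

instance isProbabilityMeasure_symmetrized (F : Measure ℝ) [IsProbabilityMeasure F] :
    IsProbabilityMeasure (symmetrized F) :=
  Measure.isProbabilityMeasure_map (by fun_prop)

theorem integrable_cos_mul (G : Measure ℝ) [IsFiniteMeasure G] (t : ℝ) :
    Integrable (fun x => Real.cos (t * x)) G :=
  .of_bound (by fun_prop) 1 (ae_of_all _ fun x => by
    simpa using Real.abs_cos_le_one (t * x))

theorem norm_charFun_sq (F : Measure ℝ) [IsProbabilityMeasure F] (t : ℝ) :
    ‖charFun F t‖ ^ 2 = ∫ x, Real.cos (t * x) ∂(symmetrized F) := by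
  have h1 : charFun (symmetrized F) t = charFun F t * charFun F (-t) := by
    rw [symmetrized, charFun_apply_real, integral_map (by fun_prop) (by fun_prop),
      charFun_apply_real, charFun_apply_real, ← integral_prod_mul]
    refine integral_congr_ae (ae_of_all _ fun p => ?_)
    simp only
    rw [← Complex.exp_add]
    push_cast
    ring_nf
  have h2 : ∫ x, Real.cos (t * x) ∂(symmetrized F) = (charFun (symmetrized F) t).re := by
    have hi : Integrable (fun x : ℝ => Complex.exp (t * x * Complex.I)) (symmetrized F) := by
      refine Integrable.of_bound (by fun_prop) 1 (ae_of_all _ fun x => ?_)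
      rw [← Complex.ofReal_mul, Complex.norm_exp_ofReal_mul_I]
    rw [charFun_apply_real, ← RCLike.re_eq_complex_re, ← integral_re hi]
    refine integral_congr_ae (ae_of_all _ fun x => ?_)
    simp only [RCLike.re_eq_complex_re]
    rw [← Complex.ofReal_mul, Complex.exp_ofReal_mul_I_re]
  rw [h2, h1, charFun_neg, Complex.mul_conj', ← Complex.ofReal_pow, Complex.ofReal_re]

theorem norm_charFun_le_exp (F : Measure ℝ) [IsProbabilityMeasure F] (t : ℝ) :
    ‖charFun F t‖ ≤ Real.exp (-∫ x, (1 - Real.cos (t * x)) / 2 ∂(symmetrized F)) := by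
  refine le_of_sq_le_sq ?_ (Real.exp_pos _).le
  rw [← Real.exp_nat_mul, norm_charFun_sq, integral_div,
    integral_sub (integrable_const _) (integrable_cos_mul _ t)]
  simp only [integral_const, probReal_univ, smul_eq_mul]
  refine (Real.add_one_le_exp (_ - 1)).trans' (by linarith) |>.trans_eq ?_
  congr 1
  push_cast
  ring

/-- The function `s ↦ ∑ k, (1 - cos (a k * s))`, which governs the decay of the characteristic
function of `∑ k, a k * X k`. -/
def cosDefect {n : ℕ} (a : EuclideanSpace ℝ (Fin n)) (s : ℝ) : ℝ :=
  ∑ k, (1 - Real.cos (a k * s))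

section CosDefect

variable {n : ℕ} (a : EuclideanSpace ℝ (Fin n))

theorem cosDefect_nonneg (s : ℝ) : 0 ≤ cosDefect a s :=
  Finset.sum_nonneg fun _ _ => sub_nonneg.2 (Real.cos_le_one _)

theorem cosDefect_le (s : ℝ) : cosDefect a s ≤ 2 * n := by
  calc cosDefect a s ≤ ∑ _k : Fin n, (2 : ℝ) :=
        Finset.sum_le_sum fun k _ => by linarith [Real.neg_one_le_cos (a k * s)]
    _ = 2 * n := by simp [mul_comm]

@[simp]
theorem cosDefect_zero : cosDefect a 0 = 0 := by simp [cosDefect]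

@[fun_prop]
theorem continuous_cosDefect : Continuous (cosDefect a) := by
  unfold cosDefect
  fun_prop

theorem cosDefect_abs (s : ℝ) : cosDefect a |s| = cosDefect a s := by
  rcases abs_cases s with ⟨h, _⟩ | ⟨h, _⟩ <;> simp [cosDefect, h]

theorem integrable_cosDefect_mul (G : Measure ℝ) [IsFiniteMeasure G] (t : ℝ) :
    Integrable (fun x => cosDefect a (t * x)) G :=
  .of_bound (by fun_prop) (2 * n) (ae_of_all _ fun x => by
    rw [Real.norm_eq_abs, abs_of_nonneg (cosDefect_nonneg a _)]
    exact cosDefect_le a _)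

/-- `exp (-κ * cosDefect a)` is a constant multiple of the exponential of a nonnegative
combination of cosines. -/
theorem exists_isCosineSum_exp_neg_mul_cosDefect {κ : ℝ} (hκ : 0 ≤ κ) :
    ∃ f, IsCosineSum f ∧
      ∀ s, Real.exp (-(κ * cosDefect a s)) = Real.exp (-(κ * n)) * Real.exp (f s) := by
  refine ⟨_, IsCosineSum.sum Finset.univ fun k _ => .const_mul_cos hκ (a k), fun s => ?_⟩
  rw [← Real.exp_add, cosDefect, Finset.sum_sub_distrib, ← Finset.mul_sum]
  simp only [Finset.sum_const, Finset.card_univ, Fintype.card_fin, nsmul_eq_mul, mul_one]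
  congr 1
  ring

theorem integral_exp_neg_mul_cosDefect_le_of_le {κ : ℝ} (hκ : 0 ≤ κ) {R R' : ℝ} (hR : 0 < R)
    (hR' : R ≤ R') :
    ∫ s in (0 : ℝ)..R', Real.exp (-(κ * cosDefect a s)) ≤
      12 * (R' / R) * ∫ s in (0 : ℝ)..R, Real.exp (-(κ * cosDefect a s)) := by
  obtain ⟨f, hf, hfe⟩ := exists_isCosineSum_exp_neg_mul_cosDefect a hκ
  simp only [hfe, intervalIntegral.integral_const_mul]
  rw [mul_left_comm]
  exact mul_le_mul_of_nonneg_left (hf.integral_exp_le_of_le hR hR') (Real.exp_pos _).le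

end CosDefect

theorem norm_charFun_sum_le {Ω : Type*} [MeasurableSpace Ω] {μ : Measure Ω}
    [IsProbabilityMeasure μ] {F : Measure ℝ} [IsProbabilityMeasure F] {n : ℕ}
    {X : Fin n → Ω → ℝ} (hX : ∀ k, HasLaw (X k) F μ) (hind : iIndepFun X μ)
    (a : EuclideanSpace ℝ (Fin n)) (t : ℝ) :
    ‖charFun (μ.map fun ω => ∑ k, a k * X k ω) t‖ ≤
      Real.exp (-∫ x, cosDefect a (t * x) / 2 ∂(symmetrized F)) := by
  have hind' : iIndepFun (fun k ω => a k * X k ω) μ :=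
    hind.comp (fun k x => a k * x) fun _ => by fun_prop
  have hmeas : ∀ k, AEMeasurable (fun ω => a k * X k ω) μ :=
    fun k => (hX k).aemeasurable.const_mul _
  rw [hind'.charFun_map_fun_sum_eq_prod hmeas, Finset.prod_apply, norm_prod]
  have hk : ∀ k, charFun (μ.map fun ω => a k * X k ω) t = charFun F (a k * t) := fun k => by
    rw [charFun_map_mul_comp (hX k).aemeasurable, (hX k).map_eq]
  simp only [hk]
  refine (Finset.prod_le_prod (fun k _ => norm_nonneg _)
    fun k _ => norm_charFun_le_exp F (a k * t)).trans_eq ?_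
  rw [← Real.exp_sum, Finset.sum_neg_distrib, ← integral_finsetSum]
  · simp only [cosDefect, Finset.sum_div, mul_assoc]
  · intro k _
    exact ((integrable_const _).sub (integrable_cos_mul _ _)).div_const _

/-- Jensen's inequality for `exp` and the probability measure `(m / M) • G`, where `M = ∫ m`. -/
theorem exp_neg_integral_le {G : Measure ℝ} [IsFiniteMeasure G] {m S : ℝ → ℝ}
    (hm : Integrable m G) (hm0 : ∀ x, 0 ≤ m x) (hmS : ∀ x, m x = 0 → S x = 0)
    (hS : Integrable S G) (hS0 : ∀ x, 0 ≤ S x) (hM : 0 < ∫ x, m x ∂G) :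
    Real.exp (-∫ x, S x ∂G) ≤
      (∫ x, m x ∂G)⁻¹ * ∫ x, m x * Real.exp (-((∫ x, m x ∂G) / m x * S x)) ∂G := by
  set M := ∫ x, m x ∂G with hMdef
  set b := ∫ x, S x ∂G with hbdef
  rw [inv_mul_eq_div, le_div_iff₀ hM]
  have hint : Integrable (fun x => m x * Real.exp (-(M / m x * S x))) G := by
    refine hm.mul_bdd (c := 1) ?_ (ae_of_all _ fun x => ?_)
    · have := hm.aestronglyMeasurable.aemeasurable
      have := hS.aestronglyMeasurable.aemeasurable
      exact AEMeasurable.aestronglyMeasurable (by fun_prop)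
    · rw [Real.norm_eq_abs, Real.abs_exp, Real.exp_le_one_iff]
      exact neg_nonpos.2 (mul_nonneg (div_nonneg hM.le (hm0 x)) (hS0 x))
  -- The tangent line of `exp (-·)` at `b` minorizes the integrand.
  calc Real.exp (-b) * M = ∫ x, Real.exp (-b) * (m x * (1 + b) - M * S x) ∂G := by
        rw [integral_const_mul, integral_sub (hm.mul_const _) (hS.const_mul _),
          integral_mul_const, integral_const_mul, ← hMdef, ← hbdef]
        ring
    _ ≤ _ := by
        refine integral_mono (((hm.mul_const _).sub (hS.const_mul _)).const_mul _) hint fun x => ?_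
        rcases (hm0 x).eq_or_lt with h | h
        · simp [← h, hmS x h.symm]
        · have h1 : 1 + b - M / m x * S x ≤ Real.exp (b - M / m x * S x) := by
            linarith [Real.add_one_le_exp (b - M / m x * S x)]
          calc _ = Real.exp (-b) * (m x * (1 + b - M / m x * S x)) := by field_simp
            _ ≤ Real.exp (-b) * (m x * Real.exp (b - M / m x * S x)) := by gcongr
            _ = m x * Real.exp (-(M / m x * S x)) := by
              rw [mul_left_comm, ← Real.exp_add]; ring_nf

/-! ### The arithmetic condition and decay of the characteristic function -/

theorem eight_mul_sub_round_sq_le (y : ℝ) :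
    8 * (y - round y) ^ 2 ≤ 1 - Real.cos (2 * Real.pi * y) := by
  have hd : |y - round y| ≤ 1 / 2 := abs_sub_round y
  have hcos : Real.cos (2 * Real.pi * y) = Real.cos (2 * Real.pi * (y - round y)) := by
    rw [mul_sub, mul_comm (2 * Real.pi) (round y : ℝ), Real.cos_sub_int_mul_two_pi]
  have h := Real.cos_le_one_sub_mul_cos_sq (x := 2 * Real.pi * (y - round y)) (by
    rw [abs_mul, abs_of_pos Real.two_pi_pos]
    nlinarith [Real.pi_pos])
  have h2 : 2 / Real.pi ^ 2 * (2 * Real.pi * (y - round y)) ^ 2 = 8 * (y - round y) ^ 2 := by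
    field_simp
    ring
  rw [hcos]
  linarith

theorem fL_nonneg {L t : ℝ} (hL : 0 ≤ L) (ht : 0 ≤ t) : 0 ≤ fL L t := by
  unfold fL
  split_ifs <;> positivity

theorem eight_mul_fL_sq_le_cosDefect {L : ℝ} (hL : 0 ≤ L) {n : ℕ}
    (a : EuclideanSpace ℝ (Fin n)) {u : ℝ} (hu : 0 < u) (huD : u < altDenominator L a) :
    8 * fL L (u * ‖a‖) ^ 2 ≤ cosDefect a (2 * Real.pi * u) := by
  set m : EuclideanSpace ℝ (Fin n) := WithLp.toLp 2 fun k => (round (u * a k) : ℝ) with hm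
  have h1 : fL L (u * ‖a‖) ≤ ‖u • a - m‖ :=
    fL_le_norm_sub hu huD fun k => ⟨round (u * a k), rfl⟩
  have h2 : fL L (u * ‖a‖) ^ 2 ≤ ‖u • a - m‖ ^ 2 :=
    pow_le_pow_left₀ (fL_nonneg hL (by positivity)) h1 2
  have h3 : ‖u • a - m‖ ^ 2 = ∑ k, (u * a k - round (u * a k)) ^ 2 := by
    rw [EuclideanSpace.real_norm_sq_eq]
    simp [hm]
  calc _ ≤ 8 * ∑ k, (u * a k - round (u * a k)) ^ 2 := by rw [← h3]; linarith
    _ = ∑ k, 8 * (u * a k - round (u * a k)) ^ 2 := Finset.mul_sum _ _ _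
    _ ≤ _ := Finset.sum_le_sum fun k _ => by
        rw [show a k * (2 * Real.pi * u) = 2 * Real.pi * (u * a k) by ring]
        exact eight_mul_sub_round_sq_le _

/-- On both ranges of `f_L`, the function `exp (-4 B f_L ^ 2)` is dominated by a Cauchy profile of
width `1 / √B`; this is where `B L ^ 2 ≥ 1` enters. -/
theorem exp_neg_fL_sq_le {L B v : ℝ} (hL : 0 < L) (hB : 0 < B) (hBL : 1 ≤ B * L ^ 2)
    (hv : 0 < v) : Real.exp (-(4 * B * fL L v ^ 2)) ≤ 9 * (1 + B * v ^ 2)⁻¹ := by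
  have hBv : 0 < B * v ^ 2 := by positivity
  rw [← div_eq_mul_inv, Real.exp_neg, inv_eq_one_div, div_le_div_iff₀ (Real.exp_pos _)
    (by linarith)]
  unfold fL
  split_ifs with h
  · have h1 := Real.add_one_le_exp (4 * B * (v / 6) ^ 2)
    have h2 : 4 * B * (v / 6) ^ 2 = B * v ^ 2 / 9 := by ring
    rw [h2] at h1 ⊢
    linarith
  · set y := v / L with hy
    set q := B * L ^ 2 with hq
    have hey : Real.exp 1 ≤ y := by rw [hy, le_div_iff₀ hL]; exact not_lt.1 h
    have hy0 : 0 < y := (Real.exp_pos 1).trans_le hey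
    have hlog : 1 ≤ Real.log y := (Real.le_log_iff_exp_le hy0).2 hey
    have hexp : 4 * B * (L * √(Real.log y)) ^ 2 = 4 * q * Real.log y := by
      rw [mul_pow, Real.sq_sqrt (by linarith), hq]; ring
    have hqy : B * v ^ 2 = q * y ^ 2 := by rw [hq, hy]; field_simp
    rw [hexp, hqy]
    -- `y ^ (4 q) ≥ y ^ 2 * exp (4 q - 2)`, and `exp (4 q - 2) ≥ q`.
    have h1 : Real.exp (2 * Real.log y) = y ^ 2 := by
      rw [two_mul, Real.exp_add, Real.exp_log hy0, sq]
    have h2 : q ≤ Real.exp ((4 * q - 2) * Real.log y) := by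
      have := Real.add_one_le_exp ((4 * q - 2) * Real.log y)
      nlinarith [mul_le_mul_of_nonneg_left hlog (by linarith : 0 ≤ 4 * q - 2)]
    have h3 : q * y ^ 2 ≤ Real.exp (4 * q * Real.log y) := by
      calc q * y ^ 2 ≤ Real.exp ((4 * q - 2) * Real.log y) * Real.exp (2 * Real.log y) := by
            rw [h1]; gcongr
        _ = _ := by rw [← Real.exp_add]; ring_nf
    have h4 : 1 ≤ Real.exp (4 * q * Real.log y) := Real.one_le_exp (by positivity)
    linarith

theorem integral_inv_one_add_mul_sq_le {c : ℝ} (hc : 0 < c) (R : ℝ) :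
    ∫ s in (0 : ℝ)..R, (1 + (c * s) ^ 2)⁻¹ ≤ Real.pi / (2 * c) := by
  rw [intervalIntegral.integral_comp_mul_left (fun x => (1 + x ^ 2)⁻¹) hc.ne',
    integral_inv_one_add_sq, smul_eq_mul, mul_zero, Real.arctan_zero, sub_zero]
  rw [show Real.pi / (2 * c) = c⁻¹ * (Real.pi / 2) by field_simp]
  gcongr
  exact (Real.arctan_lt_pi_div_two _).le

/-- Below the denominator `D*(a)`, the arithmetic condition bounds the integral of
`exp (-(B / 2) * cosDefect a)`. -/
theorem integral_exp_neg_cosDefect_le {L B R : ℝ} (hL : 0 < L) (hB : 0 < B)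
    (hBL : 1 ≤ B * L ^ 2) {n : ℕ} {a : EuclideanSpace ℝ (Fin n)} (ha : a ≠ 0) (hR : 0 ≤ R)
    (hRD : R ≤ altDenominator L a) :
    ∫ s in (0 : ℝ)..R, Real.exp (-(B / 2 * cosDefect a s)) ≤
      9 * Real.pi ^ 2 / (‖a‖ * √B) := by
  have hna : 0 < ‖a‖ := norm_pos_iff.2 ha
  have hpi := Real.pi_gt_three
  set c := √B * ‖a‖ / (2 * Real.pi) with hc
  have hc0 : 0 < c := by positivity
  have hne : ∀ s, 1 + (c * s) ^ 2 ≠ 0 := fun s => by positivity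
  calc _ ≤ ∫ s in (0 : ℝ)..R, 9 * (1 + (c * s) ^ 2)⁻¹ := by
        refine intervalIntegral.integral_mono_on_of_le_Ioo hR
          (Continuous.intervalIntegrable (by fun_prop) _ _)
          (Continuous.intervalIntegrable (by fun_prop (disch := assumption)) _ _) fun s hs => ?_
        have hs0 : 0 < s := hs.1
        set u := s / (2 * Real.pi) with hu
        have hu0 : 0 < u := by positivity
        have huD : u < altDenominator L a := by
          have : u < s := div_lt_self hs0 (by linarith)
          linarith [hs.2]
        have h1 := eight_mul_fL_sq_le_cosDefect hL.le a hu0 huD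
        rw [show 2 * Real.pi * u = s by rw [hu]; field_simp] at h1
        have h2 := exp_neg_fL_sq_le hL hB hBL (mul_pos hu0 hna)
        have h3 : B * (u * ‖a‖) ^ 2 = (c * s) ^ 2 := by
          rw [hc, hu, ← Real.sq_sqrt hB.le, Real.sqrt_sq (Real.sqrt_nonneg B)]
          ring
        rw [h3] at h2
        refine (Real.exp_le_exp.2 ?_).trans h2
        nlinarith
    _ ≤ 9 * (Real.pi / (2 * c)) := by
        rw [intervalIntegral.integral_const_mul]
        exact mul_le_mul_of_nonneg_left (integral_inv_one_add_mul_sq_le hc0 R) (by norm_num)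
    _ = _ := by rw [hc]; field_simp

/-- The weight `min (x ^ 2 / τ ^ 2) 1` makes the bound uniform in `x`: if `|x| < τ`, the smaller
weight sharpens the exponent and compensates the factor `1 / |x|` of the substitution `s = t x`;
if `|x| ≥ τ`, translation reduces the longer range of `s` to `[0, D*(a)]`. -/
theorem integral_exp_neg_div_mul_cosDefect_le {L M T τ x : ℝ} (hL : 0 < L) (hM : 0 < M)
    (hML : 1 ≤ M * L ^ 2) {n : ℕ} {a : EuclideanSpace ℝ (Fin n)} (ha : a ≠ 0) (hτ : 0 < τ)
    (hT : 0 < T) (hTτ : T * τ = altDenominator L a) (hx : x ≠ 0) :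
    ∫ t in (0 : ℝ)..T, Real.exp (-(M / min (x ^ 2 / τ ^ 2) 1 * (cosDefect a (t * x) / 2))) ≤
      108 * Real.pi ^ 2 / (‖a‖ * √M * τ) := by
  have hna : 0 < ‖a‖ := norm_pos_iff.2 ha
  have hx0 : 0 < |x| := abs_pos.2 hx
  set B := M / min (x ^ 2 / τ ^ 2) 1 with hB
  have hm0 : 0 < min (x ^ 2 / τ ^ 2) 1 := lt_min (by positivity) one_pos
  have hB0 : 0 < B := by positivity
  have hMB : M ≤ B := by
    rw [hB, le_div_iff₀ hm0]
    exact mul_le_of_le_one_right hM.le (min_le_right _ _)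
  have hBL : 1 ≤ B * L ^ 2 := hML.trans (by gcongr)
  have hsubst : ∫ t in (0 : ℝ)..T, Real.exp (-(B * (cosDefect a (t * x) / 2))) =
      |x|⁻¹ * ∫ s in (0 : ℝ)..(T * |x|), Real.exp (-(B / 2 * cosDefect a s)) := by
    have h := intervalIntegral.integral_comp_mul_right
      (fun s => Real.exp (-(B / 2 * cosDefect a s))) hx0.ne' (a := 0) (b := T)
    rw [zero_mul, smul_eq_mul] at h
    rw [← h]
    refine intervalIntegral.integral_congr fun t ht => ?_
    rw [Set.uIcc_of_le hT.le] at ht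
    rw [← cosDefect_abs a (t * x), abs_mul, abs_of_nonneg ht.1]
    ring_nf
  rw [hsubst]
  rcases lt_or_ge |x| τ with hlt | hge
  · have h1 : T * |x| ≤ altDenominator L a := by rw [← hTτ]; gcongr
    have hmin : min (x ^ 2 / τ ^ 2) 1 = (|x| / τ) ^ 2 := by
      rw [div_pow, sq_abs, min_eq_left]
      rw [div_le_one (by positivity), ← sq_abs]
      gcongr
    have hsqrt : √B = √M * τ / |x| := by
      rw [hB, hmin, Real.sqrt_div hM.le, Real.sqrt_sq (by positivity)]
      field_simp
    have h2 := integral_exp_neg_cosDefect_le hL hB0 hBL ha (by positivity) h1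
    calc _ ≤ |x|⁻¹ * (9 * Real.pi ^ 2 / (‖a‖ * √B)) := by gcongr
      _ = 9 * Real.pi ^ 2 / (‖a‖ * √M * τ) := by rw [hsqrt]; field_simp
      _ ≤ _ := by gcongr; norm_num
  · have hmin : min (x ^ 2 / τ ^ 2) 1 = 1 := by
      rw [min_eq_right]
      rw [one_le_div (by positivity), ← sq_abs x]
      gcongr
    have hBM : B = M := by rw [hB, hmin, div_one]
    have hR : 0 < T * τ := by positivity
    have h1 := integral_exp_neg_mul_cosDefect_le_of_le a (κ := B / 2) (by positivity) hR
      (mul_le_mul_of_nonneg_left hge hT.le)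
    have h2 := integral_exp_neg_cosDefect_le hL hB0 hBL ha hR.le hTτ.le
    calc _ ≤ |x|⁻¹ * (12 * (T * |x| / (T * τ)) * (9 * Real.pi ^ 2 / (‖a‖ * √B))) := by
          refine mul_le_mul_of_nonneg_left (h1.trans ?_) (by positivity)
          gcongr
      _ = _ := by rw [hBM]; field_simp; ring

/-! ### The truncated second moment -/

theorem min_sq_div_sq_mem_Icc (x τ : ℝ) : min (x ^ 2 / τ ^ 2) 1 ∈ Set.Icc (0 : ℝ) 1 :=
  ⟨le_min (by positivity) zero_le_one, min_le_right _ _⟩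

theorem norm_min_sq_div_sq_le (x τ : ℝ) : ‖min (x ^ 2 / τ ^ 2) 1‖ ≤ 1 := by
  rw [Real.norm_eq_abs, abs_of_nonneg (min_sq_div_sq_mem_Icc x τ).1]
  exact (min_sq_div_sq_mem_Icc x τ).2

theorem integrable_min_sq_div_sq (G : Measure ℝ) [IsFiniteMeasure G] (τ : ℝ) :
    Integrable (fun x => min (x ^ 2 / τ ^ 2) 1) G :=
  .of_bound (Continuous.aestronglyMeasurable (by fun_prop)) 1
    (ae_of_all _ fun x => norm_min_sq_div_sq_le x τ)

section TruncMoment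

variable (F : Measure ℝ) [IsProbabilityMeasure F]

theorem truncMoment_anti {σ τ : ℝ} (hσ : 0 < σ) (hστ : σ ≤ τ) :
    truncMoment F τ ≤ truncMoment F σ :=
  integral_mono (integrable_min_sq_div_sq _ τ) (integrable_min_sq_div_sq _ σ) fun x =>
    min_le_min_right 1 (by gcongr)

theorem continuousOn_truncMoment : ContinuousOn (truncMoment F) (Set.Ioi 0) := by
  refine continuousOn_of_dominated (bound := fun _ => 1)
    (fun τ _ => (integrable_min_sq_div_sq _ τ).aestronglyMeasurable)
    (fun τ _ => ae_of_all _ fun x => norm_min_sq_div_sq_le x τ) (integrable_const _)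
    (ae_of_all _ fun x => ?_)
  have hdiv : ContinuousOn (fun τ : ℝ => x ^ 2 / τ ^ 2) (Set.Ioi 0) :=
    continuousOn_const.div (by fun_prop) fun τ hτ => pow_ne_zero 2 (ne_of_gt hτ)
  exact (continuous_id.min continuous_const).comp_continuousOn hdiv

theorem tendsto_truncMoment_nhdsGT_zero :
    Tendsto (truncMoment F) (𝓝[>] 0) (𝓝 (probNonzero F)) := by
  have hs : MeasurableSet {x : ℝ | x ≠ 0} := (measurableSet_singleton 0).compl
  have hP : probNonzero F = ∫ x, ({x : ℝ | x ≠ 0}).indicator (fun _ => (1 : ℝ)) x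
      ∂(symmetrized F) := by
    rw [integral_indicator_const _ hs, smul_eq_mul, mul_one, probNonzero]
  rw [hP]
  refine tendsto_integral_filter_of_dominated_convergence (fun _ => 1)
    (Eventually.of_forall fun τ => (integrable_min_sq_div_sq _ τ).aestronglyMeasurable)
    (Eventually.of_forall fun τ => ae_of_all _ fun x => norm_min_sq_div_sq_le x τ)
    (integrable_const _) (ae_of_all _ fun x => ?_)
  by_cases hx : x = 0
  · simp [hx]
  · rw [Set.indicator_of_mem (show x ∈ {x : ℝ | x ≠ 0} from hx)]
    refine tendsto_const_nhds.congr' ?_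
    filter_upwards [Ioo_mem_nhdsGT (abs_pos.2 hx)] with τ hτ
    rw [min_eq_right]
    rw [one_le_div (pow_pos hτ.1 2), ← sq_abs x]
    exact pow_le_pow_left₀ hτ.1.le hτ.2.le 2

theorem tendsto_truncMoment_atTop : Tendsto (truncMoment F) atTop (𝓝 0) := by
  have h0 : (0 : ℝ) = ∫ _x, (0 : ℝ) ∂(symmetrized F) := by simp
  rw [h0]
  refine tendsto_integral_filter_of_dominated_convergence (fun _ => 1)
    (Eventually.of_forall fun τ => (integrable_min_sq_div_sq _ τ).aestronglyMeasurable)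
    (Eventually.of_forall fun τ => ae_of_all _ fun x => norm_min_sq_div_sq_le x τ)
    (integrable_const _) (ae_of_all _ fun x => ?_)
  have h1 : Tendsto (fun τ : ℝ => x ^ 2 / τ ^ 2) atTop (𝓝 0) :=
    tendsto_const_nhds.div_atTop (tendsto_pow_atTop two_ne_zero)
  simpa using h1.min (tendsto_const_nhds (x := (1 : ℝ)))

theorem exists_truncMoment_eq {y : ℝ} (hy : 0 < y) (hyP : y < probNonzero F) :
    ∃ τ, 0 < τ ∧ truncMoment F τ = y := by
  obtain ⟨σ, hσy, hσ⟩ := (((tendsto_truncMoment_nhdsGT_zero F).eventually_const_lt hyP).and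
    self_mem_nhdsWithin).exists
  obtain ⟨ρ, hρy, hρ⟩ := (((tendsto_truncMoment_atTop F).eventually_lt_const hy).and
    (eventually_gt_atTop 0)).exists
  obtain ⟨τ, hτ, hτy⟩ := isPreconnected_Ioi.intermediate_value hρ hσ
    (continuousOn_truncMoment F) ⟨hρy.le, hσy.le⟩
  exact ⟨τ, hτ, hτy⟩

end TruncMoment

/-! ### Positivity of the denominator -/

/-- The infimum defining `D*(a)` runs over a nonempty set, since `dist (t a, ℤⁿ)` is bounded and
`f_L (t ‖a‖) → ∞`. It is positive because `dist (t a, ℤⁿ) = t ‖a‖` for small `t`. -/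
theorem altDenominator_pos {L : ℝ} (hL : 0 < L) {n : ℕ} {a : EuclideanSpace ℝ (Fin n)}
    (ha : a ≠ 0) : 0 < altDenominator L a := by
  have hna : 0 < ‖a‖ := norm_pos_iff.2 ha
  have hnonempty : {t : ℝ | 0 < t ∧
      Metric.infDist (t • a) (integerPoints n) < fL L (t * ‖a‖)}.Nonempty := by
    have hlim : Tendsto (fun t => fL L (t * ‖a‖)) atTop atTop := by
      have h1 : Tendsto (fun v => L * √(Real.log (v / L))) atTop atTop :=
        (Real.tendsto_sqrt_atTop.comp (Real.tendsto_log_atTop.comp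
          (tendsto_id.atTop_div_const hL))).const_mul_atTop hL
      have h2 : Tendsto (fL L) atTop atTop := by
        refine h1.congr' ?_
        filter_upwards [eventually_ge_atTop (Real.exp 1 * L)] with v hv
        rw [fL, if_neg (not_lt.2 hv)]
      exact h2.comp (tendsto_id.atTop_mul_const hna)
    obtain ⟨t, htn, ht0⟩ := ((hlim.eventually_gt_atTop √n).and (eventually_gt_atTop 0)).exists
    refine ⟨t, ht0, lt_of_le_of_lt ?_ htn⟩
    set m : EuclideanSpace ℝ (Fin n) := WithLp.toLp 2 fun k => (round (t * a k) : ℝ) with hm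
    have hmem : m ∈ integerPoints n := fun k => ⟨round (t * a k), rfl⟩
    refine (Metric.infDist_le_dist_of_mem hmem).trans ?_
    rw [dist_eq_norm, EuclideanSpace.norm_eq]
    refine Real.sqrt_le_sqrt ?_
    calc _ ≤ ∑ _k : Fin n, (1 : ℝ) := Finset.sum_le_sum fun k _ => by
          rw [sq_le_one_iff₀ (norm_nonneg _)]
          have := abs_sub_round (t * a k)
          simp only [hm, PiLp.sub_apply, PiLp.smul_apply, smul_eq_mul, Real.norm_eq_abs]
          linarith
      _ = n := by simp
  have hsmall : ∀ t ∈ {t : ℝ | 0 < t ∧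
      Metric.infDist (t • a) (integerPoints n) < fL L (t * ‖a‖)},
      min (1 / (2 * ‖a‖)) (L / ‖a‖) ≤ t := by
    rintro t ⟨ht0, ht⟩
    by_contra! hlt
    have ht1 : t * ‖a‖ < 1 / 2 := by
      have := hlt.trans_le (min_le_left _ _)
      rw [lt_div_iff₀ (by positivity)] at this
      linarith
    have ht2 : t * ‖a‖ < L := by
      have := hlt.trans_le (min_le_right _ _)
      rwa [lt_div_iff₀ hna] at this
    have hfL : fL L (t * ‖a‖) = t * ‖a‖ / 6 := by
      rw [fL, if_pos]
      have := Real.add_one_le_exp 1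
      nlinarith
    obtain ⟨m, hm, hmt⟩ := (Metric.infDist_lt_iff (s := integerPoints n)
      ⟨0, fun k => ⟨0, by simp⟩⟩).1 ht
    rw [hfL, dist_eq_norm] at hmt
    have hta : ‖t • a‖ = t * ‖a‖ := by rw [norm_smul, Real.norm_eq_abs, abs_of_pos ht0]
    -- An integer point of norm less than `1` is zero.
    have hm1 : ‖m‖ < 1 := by
      have := norm_le_norm_add_norm_sub (t • a) m
      linarith
    have hm0 : m = 0 := by
      ext k
      obtain ⟨z, hz⟩ := hm k
      have h1 : |m k| < 1 := (PiLp.norm_apply_le m k).trans_lt hm1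
      rw [hz] at h1
      have h2 : |z| < 1 := (Int.cast_lt (R := ℝ)).1 (by rwa [Int.cast_abs, Int.cast_one])
      rw [hz, Int.abs_lt_one_iff.1 h2]
      simp
    rw [hm0, sub_zero, hta] at hmt
    have : 0 < t * ‖a‖ := by positivity
    linarith
  exact lt_of_lt_of_le (lt_min (by positivity) (by positivity)) (le_csInf hnonempty hsmall)

/-! ### Subadditivity of the concentration function -/

section Concentration

variable (H : Measure ℝ) [IsProbabilityMeasure H]

theorem bddAbove_range_real_Icc (s : ℝ) :
    BddAbove (Set.range fun x : ℝ => H.real (Set.Icc x (x + s))) :=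
  ⟨1, by rintro _ ⟨x, rfl⟩; exact measureReal_le_one⟩

theorem real_Icc_le_concentration (x s : ℝ) : H.real (Set.Icc x (x + s)) ≤ concentration H s :=
  le_ciSup (bddAbove_range_real_Icc H s) x

theorem concentration_nonneg (s : ℝ) : 0 ≤ concentration H s :=
  measureReal_nonneg.trans (real_Icc_le_concentration H 0 s)

theorem real_Icc_nat_mul_le (x : ℝ) {δ : ℝ} (hδ : 0 ≤ δ) (N : ℕ) :
    H.real (Set.Icc x (x + (N + 1) * δ)) ≤ (N + 1) * concentration H δ := by
  induction N with
  | zero => simpa using real_Icc_le_concentration H x δ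
  | succ N ih =>
    have hN : 0 ≤ (N + 1) * δ := by positivity
    have h1 : Set.Icc x (x + ((N + 1 : ℕ) + 1) * δ) = Set.Icc x (x + (N + 1) * δ) ∪
        Set.Icc (x + (N + 1) * δ) (x + (N + 1) * δ + δ) := by
      rw [Set.Icc_union_Icc_eq_Icc (by linarith) (by linarith)]
      push_cast
      ring_nf
    rw [h1]
    have h2 := real_Icc_le_concentration H (x + (N + 1) * δ) δ
    have h3 := measureReal_union_le (μ := H) (Set.Icc x (x + (N + 1) * δ))
      (Set.Icc (x + (N + 1) * δ) (x + (N + 1) * δ + δ))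
    push_cast
    linarith

theorem concentration_le_two_mul_div {δ ε : ℝ} (hδ : 0 < δ) (hδε : δ ≤ ε) :
    concentration H ε ≤ 2 * (ε / δ) * concentration H δ := by
  refine ciSup_le fun x => ?_
  have hq : 1 ≤ ε / δ := (one_le_div hδ).2 hδε
  have h1 : ε / δ < ⌊ε / δ⌋₊ + 1 := Nat.lt_floor_add_one _
  have h2 : (⌊ε / δ⌋₊ : ℝ) ≤ ε / δ := Nat.floor_le (by linarith)
  have h3 : ε ≤ (⌊ε / δ⌋₊ + 1) * δ := ((div_lt_iff₀ hδ).1 h1).le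
  calc H.real (Set.Icc x (x + ε)) ≤ H.real (Set.Icc x (x + (⌊ε / δ⌋₊ + 1) * δ)) :=
        measureReal_mono (Set.Icc_subset_Icc_right (by linarith))
    _ ≤ (⌊ε / δ⌋₊ + 1) * concentration H δ := real_Icc_nat_mul_le H x hδ.le _
    _ ≤ _ := mul_le_mul_of_nonneg_right (by linarith) (concentration_nonneg H δ)

end Concentration

/-! ### The concentration inequality for weighted sums -/

/-- The bound for `ε` such that `M(ε D*(a)) L² ≥ 1`. -/
theorem concentration_sum_le {Ω : Type*} [MeasurableSpace Ω] {μ : Measure Ω}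
    [IsProbabilityMeasure μ] {F : Measure ℝ} [IsProbabilityMeasure F] {n : ℕ}
    {X : Fin n → Ω → ℝ} (hX : ∀ k, HasLaw (X k) F μ) (hind : iIndepFun X μ)
    {a : EuclideanSpace ℝ (Fin n)} (ha : a ≠ 0) {L : ℝ} (hL : 0 < L) {ε : ℝ} (hε : 0 < ε)
    (hM : 0 < truncMoment F (ε * altDenominator L a))
    (hML : 1 ≤ truncMoment F (ε * altDenominator L a) * L ^ 2) :
    concentration (μ.map fun ω => ∑ k, a k * X k ω) ε ≤
      432 * Real.pi ^ 2 * (1 / (‖a‖ * altDenominator L a *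
        √(truncMoment F (ε * altDenominator L a)))) := by
  have hD := altDenominator_pos hL ha
  have hna : 0 < ‖a‖ := norm_pos_iff.2 ha
  set D := altDenominator L a with hDdef
  set τ := ε * D with hτdef
  have hτ : 0 < τ := by positivity
  set M := truncMoment F τ with hMdef
  set G := symmetrized F with hG
  set T := ε⁻¹ with hTdef
  have hT : 0 < T := inv_pos.2 hε
  have hTτ : T * τ = D := by rw [hTdef, hτdef]; field_simp
  set m : ℝ → ℝ := fun x => min (x ^ 2 / τ ^ 2) 1 with hm
  have hMm : M = ∫ x, m x ∂G := rfl
  have hm01 : ∀ x, m x ∈ Set.Icc (0 : ℝ) 1 := fun x => min_sq_div_sq_mem_Icc x τ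
  have hmeas : AEMeasurable (fun ω => ∑ k, a k * X k ω) μ :=
    Finset.aemeasurable_fun_sum _ fun k _ => (hX k).aemeasurable.const_mul _
  have hprob : IsProbabilityMeasure (μ.map fun ω => ∑ k, a k * X k ω) :=
    Measure.isProbabilityMeasure_map hmeas
  set e : ℝ → ℝ → ℝ := fun t x => m x * Real.exp (-(M / m x * (cosDefect a (t * x) / 2))) with he
  have hchar : ∀ t, ‖charFun (μ.map fun ω => ∑ k, a k * X k ω) t‖ ≤ M⁻¹ * ∫ x, e t x ∂G := by
    intro t
    refine (norm_charFun_sum_le hX hind a t).trans ?_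
    refine exp_neg_integral_le (m := m) (integrable_min_sq_div_sq G τ) (fun x => (hm01 x).1)
      (fun x hx => ?_) ((integrable_cosDefect_mul a G t).div_const 2)
      (fun x => div_nonneg (cosDefect_nonneg a _) zero_le_two) hM
    have hx0 : x = 0 := by
      by_contra hx0
      have : 0 < m x := lt_min (by positivity) one_pos
      exact this.ne' hx
    simp [hx0]
  have he1 : ∀ t x, ‖e t x‖ ≤ 1 := fun t x => by
    rw [he, norm_mul, Real.norm_eq_abs, Real.norm_eq_abs, Real.abs_exp, abs_of_nonneg (hm01 x).1]
    refine mul_le_one₀ (hm01 x).2 (Real.exp_pos _).le (Real.exp_le_one_iff.2 (neg_nonpos.2 ?_))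
    have := cosDefect_nonneg a (t * x)
    have := (hm01 x).1
    positivity
  have hfin : IsFiniteMeasure (volume.restrict (Set.uIoc 0 T)) :=
    ⟨by simp [Set.uIoc_of_le hT.le]⟩
  have hint : Integrable (Function.uncurry e) ((volume.restrict (Set.uIoc 0 T)).prod G) := by
    refine Integrable.of_bound (Measurable.aestronglyMeasurable ?_) 1
      (ae_of_all _ fun p => he1 p.1 p.2)
    have hcont := continuous_cosDefect a
    have hmm : Measurable m := Continuous.measurable (by fun_prop)
    have := hcont.measurable
    unfold Function.uncurry
    simp only [he]
    fun_prop
  set K := 108 * Real.pi ^ 2 / (‖a‖ * √M * τ) with hK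
  have hinner : ∀ x, ∫ t in (0 : ℝ)..T, e t x ≤ m x * K := by
    intro x
    simp only [he, intervalIntegral.integral_const_mul]
    rcases eq_or_ne x 0 with rfl | hx
    · simp [hm]
    · exact mul_le_mul_of_nonneg_left
        (integral_exp_neg_div_mul_cosDefect_le hL hM hML ha hτ hT hTτ hx) (hm01 x).1
  have hint1 : IntervalIntegrable (fun t => ∫ x, e t x ∂G) volume 0 T := by
    rw [intervalIntegrable_iff]
    exact hint.integral_prod_left
  have hint2 : Integrable (fun x => ∫ t in (0 : ℝ)..T, e t x) G := by
    simpa only [intervalIntegral.integral_of_le hT.le, Set.uIoc_of_le hT.le,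
      Function.uncurry] using hint.integral_prod_right
  calc _ ≤ 4 * ε * ∫ t in (0 : ℝ)..T, ‖charFun (μ.map fun ω => ∑ k, a k * X k ω) t‖ :=
        concentration_le_integral_charFun _ hε
    _ ≤ 4 * ε * ∫ t in (0 : ℝ)..T, M⁻¹ * ∫ x, e t x ∂G := by
        refine mul_le_mul_of_nonneg_left ?_ (by positivity)
        exact intervalIntegral.integral_mono_on hT.le intervalIntegrable_charFun.norm
          (hint1.const_mul _) fun t _ => hchar t
    _ = 4 * ε * (M⁻¹ * ∫ x, (∫ t in (0 : ℝ)..T, e t x) ∂G) := by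
        rw [intervalIntegral.integral_const_mul, intervalIntegral_integral_swap hint]
    _ ≤ 4 * ε * (M⁻¹ * ∫ x, m x * K ∂G) := by
        refine mul_le_mul_of_nonneg_left (mul_le_mul_of_nonneg_left ?_ (inv_nonneg.2 hM.le))
          (by positivity)
        exact integral_mono hint2 ((integrable_min_sq_div_sq G τ).mul_const K) hinner
    _ = 4 * ε * K := by
        rw [integral_mul_const, ← hMm]
        field_simp
    _ = _ := by
        rw [hK, hτdef]
        field_simp
        ring

end LittlewoodOfford

end

theorem theorem2 :
    ∃ c : ℝ, 0 < c ∧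
      ∀ (Ω : Type*) [MeasurableSpace Ω] (μ : Measure Ω) [IsProbabilityMeasure μ]
        (F : Measure ℝ) [IsProbabilityMeasure F]
        (n : ℕ) (X : Fin n → Ω → ℝ), (∀ k, HasLaw (X k) F μ) → iIndepFun X μ →
      ∀ (a : EuclideanSpace ℝ (Fin n)), a ≠ 0 →
      ∀ (L : ℝ), 0 < L →
        0 < LittlewoodOfford.probNonzero F → 1 / LittlewoodOfford.probNonzero F < L ^ 2 →
        Tendsto (LittlewoodOfford.truncMoment F) (𝓝[>] 0)
            (𝓝 (LittlewoodOfford.probNonzero F)) ∧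
        (∃ τ₀ : ℝ, 0 < τ₀ ∧ L ^ 2 = 1 / LittlewoodOfford.truncMoment F τ₀) ∧
        ∀ τ₀ : ℝ, 0 < τ₀ → L ^ 2 = 1 / LittlewoodOfford.truncMoment F τ₀ →
          (∀ ε : ℝ, 0 < ε → ε ≤ τ₀ / LittlewoodOfford.altDenominator L a →
            LittlewoodOfford.concentration (μ.map (fun ω => ∑ k, a k * X k ω)) ε ≤
              c * (1 / (‖a‖ * LittlewoodOfford.altDenominator L a *
                √(LittlewoodOfford.truncMoment F
                  (ε * LittlewoodOfford.altDenominator L a))))) ∧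
          (∀ ε : ℝ, τ₀ / LittlewoodOfford.altDenominator L a ≤ ε →
            LittlewoodOfford.concentration (μ.map (fun ω => ∑ k, a k * X k ω)) ε ≤
              c * (ε * L / ((τ₀ / LittlewoodOfford.altDenominator L a) *
                (‖a‖ * LittlewoodOfford.altDenominator L a)))) := by
  refine ⟨864 * Real.pi ^ 2, by positivity, ?_⟩
  intro Ω _ μ _ F _ n X hX hind a ha L hL hP hPL
  refine ⟨LittlewoodOfford.tendsto_truncMoment_nhdsGT_zero F, ?_, ?_⟩
  · have hPL' : 1 / L ^ 2 < LittlewoodOfford.probNonzero F :=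
      (one_div_lt hP (by positivity)).1 hPL
    obtain ⟨τ, hτ, hτL⟩ := LittlewoodOfford.exists_truncMoment_eq F (by positivity) hPL'
    exact ⟨τ, hτ, by rw [hτL, one_div_one_div]⟩
  intro τ₀ hτ₀ hLτ₀
  have hD := LittlewoodOfford.altDenominator_pos hL ha
  have hna : 0 < ‖a‖ := norm_pos_iff.2 ha
  set D := LittlewoodOfford.altDenominator L a with hDdef
  have hM₀ : LittlewoodOfford.truncMoment F τ₀ = 1 / L ^ 2 := by rw [hLτ₀, one_div_one_div]
  have hM₀pos : 0 < LittlewoodOfford.truncMoment F τ₀ := by rw [hM₀]; positivity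
  have hsmall : ∀ ε : ℝ, 0 < ε → ε ≤ τ₀ / D →
      LittlewoodOfford.concentration (μ.map (fun ω => ∑ k, a k * X k ω)) ε ≤
        432 * Real.pi ^ 2 * (1 / (‖a‖ * D * √(LittlewoodOfford.truncMoment F (ε * D)))) := by
    intro ε hε hετ
    have hle : LittlewoodOfford.truncMoment F τ₀ ≤ LittlewoodOfford.truncMoment F (ε * D) :=
      LittlewoodOfford.truncMoment_anti F (by positivity) ((le_div_iff₀ hD).1 hετ)
    refine LittlewoodOfford.concentration_sum_le hX hind ha hL hε (hM₀pos.trans_le hle) ?_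
    rw [← hDdef, ← div_le_iff₀ (by positivity), ← hM₀]
    exact hle
  refine ⟨fun ε hε hετ => (hsmall ε hε hετ).trans ?_, fun ε hετ => ?_⟩
  · gcongr
    norm_num
  · have hε₀ : 0 < τ₀ / D := by positivity
    have hmeas : AEMeasurable (fun ω => ∑ k, a k * X k ω) μ :=
      Finset.aemeasurable_fun_sum _ fun k _ => (hX k).aemeasurable.const_mul _
    have hprob : IsProbabilityMeasure (μ.map fun ω => ∑ k, a k * X k ω) :=
      Measure.isProbabilityMeasure_map hmeas
    have hsqrt : √(LittlewoodOfford.truncMoment F (τ₀ / D * D)) = 1 / L := by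
      rw [div_mul_cancel₀ _ hD.ne', hM₀, ← one_div_pow, Real.sqrt_sq (by positivity)]
    have h := hsmall _ hε₀ le_rfl
    rw [hsqrt] at h
    have hε : 0 < ε := hε₀.trans_le hετ
    calc _ ≤ 2 * (ε / (τ₀ / D)) *
          LittlewoodOfford.concentration (μ.map (fun ω => ∑ k, a k * X k ω)) (τ₀ / D) :=
          LittlewoodOfford.concentration_le_two_mul_div _ hε₀ hετ
      _ ≤ 2 * (ε / (τ₀ / D)) * (432 * Real.pi ^ 2 * (1 / (‖a‖ * D * (1 / L)))) := by gcongr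
      _ = _ := by field_simp; ring
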